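/- **Setting.** A finite set of qubits is bipartitioned into two systems $A|B$. A circuit of single-qubit and two-qubit gates is given in control-phase form: depths $t=1,\dots,\tau$; at depth $t$ disjoint pairs $\{q,q'\}$ undergo two-qubit blocks $(G_q\otimes G_{q'})\,C_V(\theta)\,(F_q\otimes F_{q'})$, where $C_V(\theta)=|0\rangle\langle 0|\otimes 1+|1\rangle\langle 1|\otimes \mathrm{diag}(1,e^{i\theta})$ and $F,G$ are arbitrary single-qubit unitaries, and every other qubit $q$ undergoes a single-qubit gate $G_qF_q$. Let $U_t$ be the unitary of depth $t$. A *node* $(q,t)$ is a qubit $q$ on which a control-phase gate acts at depth $t$. A *global control-Z gate* $C_Z(q,q';t)$ is a control-phase gate on $\{q,q'\}$ at depth $t$ with $e^{i\theta}=-1$, where $q$ and $q'$ lie in different systems. **Embeddings.** Let $(q,\tau_1),(q,\tau_2)$ be nodes with $\tau_1<\tau_2$. An embedding $\mathcal B_{q;\tau_1,\tau_2}$ is a decomposition of the gates strictly between the control-phase gates of the two nodes, obtained by regrouping the single-qubit gates on $q$ (inserting $c_k^{-1}c_k=1$, with $c_k$ a single-qubit unitary on $q$, at the cuts between successive depths),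 into: one unit for each $\tau_1<t<\tau_2$, and single-qubit gates on $q$ at the beginning and at the end that are diagonal or anti-diagonal. Each unit must be of one of three types: * no two-qubit gate acts on $q$, and the single-qubit gate on $q$ is diagonal or anti-diagonal; * $D$-type: a two-qubit block with $F_q$ and $G_q$ diagonal or anti-diagonal; * global $H$-type: a block with a global control-Z gate on $\{q,r\}$ for some qubit $r$, equal to $(D_2H\otimes G_r)\,C_Z\,(HD_1\otimes F_r)$ with $H$ the Hadamard gate and $D_1,D_2$ diagonal or anti-diagonal; that is, $F_q=PHD_1$, $G_q=D_2HP^{-1}$ with $P$ diagonal. The embedding is *decomposable* if there is a node $(q,t)$ with $\tau_1<t<\tau_2$ such that embeddings $\mathcal B_{q;\tau_1,t}$ and $\mathcal B_{q;t,\tau_2}$ both exist, and *indecomposable* otherwise. **Compatibility.** A packing process rooted on $q$ uses an auxiliary qubit $e$ on the system opposite to $q$. For a family of roots $q_i$ with auxiliary qubits $e_i$, let $C=\prod_i C_{q_i,X_{e_i}}$ be the product of the control-$X$ gates with control $q_i$ and target $e_i$. A kernel $K$ on working and auxiliary qubits implements $V$, written $V=\mathcal P[K]$, if all Kraus operators $\prod_i\sqrt2\langle\pm_{e_i}|\,C\,K\,C\,\prod_i|0_{e_i}\rangle$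 of the joint packing process are equal to $V$. A joint embedding rule of $V$ is a kernel $(L_A\otimes L_B)\,V\,(K_A\otimes K_B)$, with unitaries local with respect to $A|B$ (auxiliary qubits included), that implements $V$. Two embeddings are *compatible* if for every depth $t$ the unitary $U_t$, with its single-qubit gates grouped as in the embeddings whose open interval contains $t$, has a joint embedding rule for the packing processes of all these embeddings (if both embeddings are rooted on the same qubit, for the grouping of either one); otherwise they are *incompatible*. **Theorem (Compatibility of embeddings).** Two indecomposable embeddings $\mathcal B_{q;\tau_1,\tau_2}$ and $\mathcal B_{q';\tau'_1,\tau'_2}$ of such a circuit are incompatible if and only if there is a depth $t$ with $\tau_1<t<\tau_2$ and $\tau_1'<t<\tau_2'$ at which a global control-Z gate $C_Z(q,q';t)$ acts on $\{q,q'\}$. -/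

import Mathlib

open scoped Matrix

noncomputable section

namespace DQC

/-! ### Operators on qubit registers -/

/-- Operators on the Hilbert space of a register whose qubits are labelled by `ι`, as matrices in
the computational basis `ι → Fin 2`. -/
abbrev Op (ι : Type) : Type := Matrix (ι → Fin 2) (ι → Fin 2) ℂ

/-- Single-qubit gates. -/
abbrev Gate1 : Type := Matrix.unitaryGroup (Fin 2) ℂ

/-- The Hadamard matrix. -/
def hadamard : Matrix (Fin 2) (Fin 2) ℂ :=
  ((Real.sqrt 2 : ℝ) : ℂ)⁻¹ • !![1, 1; 1, -1]

/-- A single-qubit matrix that is diagonal or anti-diagonal in the computational basis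
(for unitaries: a single-qubit distributable gate). -/
def IsDiagOrAntidiag (u : Matrix (Fin 2) (Fin 2) ℂ) : Prop :=
  (u 0 1 = 0 ∧ u 1 0 = 0) ∨ (u 0 0 = 0 ∧ u 1 1 = 0)

/-- The product operator `⨂ q, u q`. -/
def tensorOp {Q : Type} [Fintype Q] (u : Q → Gate1) : Op Q :=
  Matrix.of fun x y => ∏ q, (u q).1 (x q) (y q)

/-- `a ⊗ b` for a unitary `a` on the qubits of system `A` (`side = false`) and a unitary `b` on
the qubits of system `B` (`side = true`). -/
def IsLocalUnitary {ι : Type} [Fintype ι] [DecidableEq ι] (side : ι → Bool) (M : Op ι) : Prop :=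
  ∃ a ∈ Matrix.unitaryGroup ({k : ι // side k = false} → Fin 2) ℂ,
  ∃ b ∈ Matrix.unitaryGroup ({k : ι // side k = true} → Fin 2) ℂ,
    ∀ x y : ι → Fin 2,
      M x y = a (fun k => x k) (fun k => y k) * b (fun k => x k) (fun k => y k)

/-! ### Packing processes and joint embedding rules

`Q` labels the working qubits and `E` the packing auxiliary qubits.  The packing process assisted
by `e` is rooted on the working qubit `root e`.  Roots may repeat, so that a family `root` is the
disjoint union of the root sets of several packing processes. -/

section Packing

variable {Q E : Type}

/-- `V ⊗ 1` on the working and auxiliary qubits. -/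
def liftOp [Fintype E] [DecidableEq E] (V : Op Q) : Op (Q ⊕ E) :=
  Matrix.of fun z w =>
    if (∀ e : E, z (Sum.inr e) = w (Sum.inr e)) then
      V (fun q => z (Sum.inl q)) (fun q => w (Sum.inl q))
    else 0

/-- The product of the control-`X` gates with control `root e` and target `e`, over all `e`:
`|x, y⟩ ↦ |x, y + x ∘ root⟩`. -/
def controlXs [Fintype Q] [DecidableEq Q] [Fintype E] [DecidableEq E] (root : E → Q) :
    Op (Q ⊕ E) :=
  Matrix.of fun z w =>
    if (∀ q : Q, z (Sum.inl q) = w (Sum.inl q)) ∧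
        (∀ e : E, z (Sum.inr e) = w (Sum.inr e) + w (Sum.inl (root e))) then 1 else 0

/-- The Kraus operators of the joint packing process with kernel `K`: for each choice of a sign
for every auxiliary qubit (`s e = 0` for `+`, `s e = 1` for `-`),
`(∏ e, √2 ⟨±_e|) C K C (∏ e, |0_e⟩)`, where `C` is the product of the control-`X` gates and
`√2 ⟨±| = ⟨0| ± ⟨1|`. -/
def krausOp [Fintype Q] [DecidableEq Q] [Fintype E] [DecidableEq E] (root : E → Q)
    (s : E → Fin 2) (K : Op (Q ⊕ E)) : Op Q :=
  Matrix.of fun x x' =>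
    ∑ y : E → Fin 2, (∏ e, (-1 : ℂ) ^ ((s e : ℕ) * (y e : ℕ))) *
      (controlXs root * K * controlXs root) (Sum.elim x y) (Sum.elim x' fun _ => 0)

/-- `U = 𝓟[K]`: the joint packing process with kernel `K` is canonically unitary-equivalent to
`U`, that is, all its Kraus operators are equal to `U`. -/
def PacksTo [Fintype Q] [DecidableEq Q] [Fintype E] [DecidableEq E] (root : E → Q)
    (K : Op (Q ⊕ E)) (U : Op Q) : Prop :=
  ∀ s : E → Fin 2, krausOp root s K = U

/-- The auxiliary qubit of a packing process is located on the system opposite to its root. -/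
def auxSide (side : Q → Bool) (root : E → Q) : Q ⊕ E → Bool :=
  Sum.elim side fun e => !(side (root e))

/-- `V` has an embedding rule `(L_A ⊗ L_B) V (K_A ⊗ K_B)`, with local unitaries, for the joint
packing process rooted on the family `root`. -/
def HasJointEmbeddingRule [Fintype Q] [DecidableEq Q] [Fintype E] [DecidableEq E]
    (side : Q → Bool) (root : E → Q) (V : Op Q) : Prop :=
  ∃ L K : Op (Q ⊕ E), IsLocalUnitary (auxSide side root) L ∧
    IsLocalUnitary (auxSide side root) K ∧ PacksTo root (L * liftOp V * K) V

end Packing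

/-! ### Circuits of one- and two-qubit gates -/

/-- One depth of a circuit in control-phase form.  The two-qubit gates act on the disjoint pairs
in `gates`; the gate on `e = s(q, q')` is the block
`(post q ⊗ post q') C_V(phase e) (pre q ⊗ pre q')`.  A qubit `q` that is in no pair
undergoes the single-qubit gate `post q * pre q`. -/
structure Layer (Q : Type) where
  gates : Finset (Sym2 Q)
  not_isDiag : ∀ e ∈ gates, ¬ e.IsDiag
  disjoint : ∀ e ∈ gates, ∀ e' ∈ gates, ∀ q, q ∈ e → q ∈ e' → e = e'
  phase : Sym2 Q → ℝ
  pre : Q → Gate1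
  post : Q → Gate1

namespace Layer

variable {Q : Type}

/-- The product of the control-phase gates of a layer. -/
def controlPhases (ℓ : Layer Q) [Fintype Q] [DecidableEq Q] : Op Q :=
  Matrix.diagonal fun x =>
    ∏ e ∈ ℓ.gates, if (∀ q ∈ e, x q = 1) then Complex.exp (Complex.I * (ℓ.phase e : ℂ)) else 1

/-- The unitary of a layer. -/
def op (ℓ : Layer Q) [Fintype Q] [DecidableEq Q] : Op Q :=
  tensorOp ℓ.post * ℓ.controlPhases * tensorOp ℓ.pre

/-- The layer obtained by inserting the single-qubit gates `(a q)⁻¹` before and `b q` after. -/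
def regroup (ℓ : Layer Q) (a b : Q → Gate1) : Layer Q :=
  { ℓ with
    pre := fun q => ℓ.pre q * (a q)⁻¹
    post := fun q => b q * ℓ.post q }

/-- There is a control-phase gate on `q` in this layer. -/
def IsNode (ℓ : Layer Q) (q : Q) : Prop := ∃ e ∈ ℓ.gates, q ∈ e

/-- There is a control-phase gate between the two qubits; it is a control-`Z` gate (its phase is
`π` modulo `2π`), and it is global. -/
def IsGlobalCZ (side : Q → Bool) (ℓ : Layer Q) (q q' : Q) : Prop :=
  s(q, q') ∈ ℓ.gates ∧ Complex.exp (Complex.I * (ℓ.phase s(q, q') : ℂ)) = -1 ∧ side q ≠ side q'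

/-- Single-qubit rule: no two-qubit gate on `q`, and the single-qubit gate on `q` is diagonal or
anti-diagonal. -/
def IsIdleUnit (ℓ : Layer Q) (q : Q) : Prop :=
  ¬ ℓ.IsNode q ∧ IsDiagOrAntidiag ((ℓ.post q).1 * (ℓ.pre q).1)

/-- `D`-type two-qubit block on `q`. -/
def IsDTypeUnit (ℓ : Layer Q) (q : Q) : Prop :=
  ℓ.IsNode q ∧ IsDiagOrAntidiag (ℓ.pre q).1 ∧ IsDiagOrAntidiag (ℓ.post q).1

/-- Global `H`-type control-`Z` block on `q`: the block equals
`(D₂ H ⊗ G') C_Z (H D₁ ⊗ F')` on `{q, q'}` with `D₁, D₂` diagonal or anti-diagonal.  The diagonal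
gate `P` accounts for phase gates on `q`, which commute with the control-phase gate and may be
moved from one side of it to the other. -/
def IsHTypeUnit (side : Q → Bool) (ℓ : Layer Q) (q : Q) : Prop :=
  (∃ q', ℓ.IsGlobalCZ side q q') ∧
  ∃ P D₁ D₂ : Gate1, (P.1 0 1 = 0 ∧ P.1 1 0 = 0) ∧
    IsDiagOrAntidiag D₁.1 ∧ IsDiagOrAntidiag D₂.1 ∧
    (ℓ.pre q).1 = P.1 * hadamard * D₁.1 ∧ (ℓ.post q).1 = D₂.1 * hadamard * (P⁻¹).1

end Layer

/-- A circuit on the qubits `Q`, bipartitioned into the systems `A` (`side = false`) and `B`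
(`side = true`).  Layer `0` acts first. -/
structure Circuit (Q : Type) where
  side : Q → Bool
  depth : ℕ
  layer : Fin depth → Layer Q

/-! ### Embeddings -/

variable {Q : Type}

/-- An embedding `𝓑_{q; τ₁, τ₂}` of a circuit, with `q = root`, `τ₁ = first`, `τ₂ = last`, where
`(q, τ₁)` and `(q, τ₂)` are control-phase nodes.

The gates strictly between the two control-phase gates are decomposed into one embedding unit
for each depth `first < t < last`, preceded and followed by a distributable single-qubit gate on
`q`.  Such a decomposition assigns the single-qubit gates on `q` to the units: `cut k` is the
gate on `q` that is moved across the cut just before depth `k` (`(cut k)⁻¹ * cut k = 1` is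
inserted there). -/
structure Embedding [DecidableEq Q] (C : Circuit Q) where
  root : Q
  first : Fin C.depth
  last : Fin C.depth
  first_lt_last : first < last
  first_node : (C.layer first).IsNode root
  last_node : (C.layer last).IsNode root
  cut : Fin (C.depth + 1) → Gate1
  first_gate : IsDiagOrAntidiag (cut first.succ * (C.layer first).post root : Gate1).1
  last_gate : IsDiagOrAntidiag ((C.layer last).pre root * (cut last.castSucc)⁻¹ : Gate1).1
  units : ∀ t, first < t → t < last →
    let ℓ := (C.layer t).regroup (Pi.mulSingle root (cut t.castSucc))
      (Pi.mulSingle root (cut t.succ))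
    ℓ.IsIdleUnit root ∨ ℓ.IsDTypeUnit root ∨ ℓ.IsHTypeUnit C.side root

namespace Embedding

variable [DecidableEq Q] {C : Circuit Q}

/-- The depth `t` lies strictly inside the interval of the embedding. -/
abbrev Covers (𝓑 : Embedding C) (t : Fin C.depth) : Prop := 𝓑.first < t ∧ t < 𝓑.last

/-- `𝓑_{q; τ₁, τ₂}` is decomposable: for a control-phase node `(q, t)` with `τ₁ < t < τ₂` it can
be replaced by embeddings `𝓑_{q; τ₁, t}` and `𝓑_{q; t, τ₂}` and a distributing process at `t`. -/
def IsDecomposable (𝓑 : Embedding C) : Prop :=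
  ∃ t, 𝓑.Covers t ∧ ∃ 𝓑₁ 𝓑₂ : Embedding C,
    (𝓑₁.root = 𝓑.root ∧ 𝓑₁.first = 𝓑.first ∧ 𝓑₁.last = t) ∧
    (𝓑₂.root = 𝓑.root ∧ 𝓑₂.first = t ∧ 𝓑₂.last = 𝓑.last)

/-- The gates assigned to depth `t` by the embeddings `𝓑 i` that cover `t`: on every line `q`, the
cuts of one of the covering embeddings rooted on `q`, or no change if there is none. -/
def IsGrouping {ι : Type} (𝓑 : ι → Embedding C) (t : Fin C.depth) (a b : Q → Gate1) : Prop :=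
  ∀ q,
    (∃ i, (𝓑 i).Covers t ∧ (𝓑 i).root = q ∧
      a q = (𝓑 i).cut t.castSucc ∧ b q = (𝓑 i).cut t.succ) ∨
    ((∀ i, (𝓑 i).Covers t → (𝓑 i).root ≠ q) ∧ a q = 1 ∧ b q = 1)

/-- A family of embeddings is compatible if at each depth `t` the embedding unit has a joint
embedding rule for the packing processes of all embeddings that cover `t`. -/
def Compatible [Fintype Q] {ι : Type} [Fintype ι] [DecidableEq ι] (𝓑 : ι → Embedding C) : Prop :=
  ∀ (t : Fin C.depth) (a b : Q → Gate1), IsGrouping 𝓑 t a b →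
    HasJointEmbeddingRule C.side (fun i : {i // (𝓑 i).Covers t} => (𝓑 i.1).root)
      ((C.layer t).regroup a b).op

end Embedding

end DQC

end

/-! A D-type unit is a place where its embedding can be cut in two, so inside an indecomposable
embedding every unit is idle or global H-type (`isIdleUnit_or_isHTypeUnit`). By Fourier inversion
over the signs of the Kraus operators, a kernel implements V exactly when it acts as V on the states
in which every auxiliary bit copies its root bit (`packsTo_iff`). The question is therefore whether
local unitaries can keep all copies synchronised with their roots.

Without a shared gate they can (`hasJointEmbeddingRule_of_units`). An idle unit flips its root by a
constant. In an H-type unit the Hadamards turn the control-Z into a control-X targeting the root, so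
the root is flipped by a constant plus the bit of the partner r, once the last gate on r is
stripped. As r lies in the opposite system, where the auxiliary qubit is, a local permutation flips
the copy accordingly. The stripped gates are undone and redone around that permutation; they touch
no root because no two roots share a global control-Z.

With a shared gate, operator Schmidt rank forbids it (`not_hasJointEmbeddingRule`). Let S be the
realignment of everything but the shared gate. The control-Z is a sum of two product operators, so V
⊗ 1 has rank at most 2 rank S, and local unitaries do not increase this. Yet synchronised copies
expose both output root bits to both systems, and the kernel's realignment contains a block-diagonal
submatrix with four nonzero multiples of S. Hence 4 rank S ≤ 2 rank S, so S = 0 and the layer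
vanishes, which is absurd. -/

noncomputable section

namespace DQC

/-! ### Product, permutation and local operators -/

section Registers

variable {ι : Type} {side : ι → Bool}

/-- The basis state of the register with the given states of the two systems. -/
def glue (side : ι → Bool) (a : {k // side k = false} → Fin 2) (b : {k // side k = true} → Fin 2) :
    ι → Fin 2 :=
  fun k => if h : side k = false then a ⟨k, h⟩ else b ⟨k, by simpa using h⟩

@[simp] theorem glue_false (a : {k // side k = false} → Fin 2) (b : {k // side k = true} → Fin 2)
    (k : {k // side k = false}) : glue side a b k = a k := by
  simp [glue, k.2]

@[simp] theorem glue_true (a : {k // side k = false} → Fin 2) (b : {k // side k = true} → Fin 2)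
    (k : {k // side k = true}) : glue side a b k = b k := by
  simp [glue, k.2]

theorem glue_of_false (a : {k // side k = false} → Fin 2) (b : {k // side k = true} → Fin 2)
    {k : ι} (h : side k = false) : glue side a b k = a ⟨k, h⟩ := by
  simp [glue, h]

theorem glue_of_true (a : {k // side k = false} → Fin 2) (b : {k // side k = true} → Fin 2)
    {k : ι} (h : side k = true) : glue side a b k = b ⟨k, h⟩ := by
  simp [glue, h]

theorem glue_restrict (z : ι → Fin 2) :
    glue side (fun k => z k) (fun k => z k) = z := by
  ext k
  simp [glue]

variable (side) in
/-- A basis state of the register is a pair of basis states of the two systems. -/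
def glueEquiv :
    ({k // side k = false} → Fin 2) × ({k // side k = true} → Fin 2) ≃ (ι → Fin 2) where
  toFun p := glue side p.1 p.2
  invFun z := (fun k => z k, fun k => z k)
  left_inv p := by ext <;> simp
  right_inv z := glue_restrict z

variable [Fintype ι]

theorem prod_one_apply (x y : ι → Fin 2) :
    ∏ q, (1 : Matrix (Fin 2) (Fin 2) ℂ) (x q) (y q) = if x = y then 1 else 0 := by
  simp only [Matrix.one_apply, Finset.prod_ite_zero, Finset.prod_const_one, Finset.mem_univ,
    true_implies, funext_iff]

theorem tensorOp_one : tensorOp (1 : ι → Gate1) = 1 := by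
  ext x y
  simp only [tensorOp, Matrix.of_apply, Pi.one_apply, Matrix.UnitaryGroup.one_val,
    Matrix.one_apply (n := ι → Fin 2), prod_one_apply]

theorem star_tensorOp (u : ι → Gate1) : star (tensorOp u) = tensorOp u⁻¹ := by
  ext x y
  simp [tensorOp, Matrix.star_apply, Matrix.UnitaryGroup.inv_val]

variable [DecidableEq ι]

theorem tensorOp_mul (u v : ι → Gate1) : tensorOp u * tensorOp v = tensorOp (u * v) := by
  ext x z
  simp only [tensorOp, Matrix.mul_apply, Matrix.of_apply, Pi.mul_apply,
    Matrix.UnitaryGroup.mul_val, ← Finset.prod_mul_distrib]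
  rw [Finset.prod_univ_sum, Fintype.piFinset_univ]

theorem tensorOp_mul_inv (u : ι → Gate1) : tensorOp u * tensorOp u⁻¹ = 1 := by
  rw [tensorOp_mul, mul_inv_cancel, tensorOp_one]

theorem tensorOp_inv_mul (u : ι → Gate1) : tensorOp u⁻¹ * tensorOp u = 1 := by
  rw [tensorOp_mul, inv_mul_cancel, tensorOp_one]

theorem tensorOp_mem_unitaryGroup (u : ι → Gate1) :
    tensorOp u ∈ Matrix.unitaryGroup (ι → Fin 2) ℂ := by
  rw [Matrix.mem_unitaryGroup_iff, star_tensorOp, tensorOp_mul_inv]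

/-- The permutation operator `|w⟩ ↦ |f w⟩`. -/
def permOp (f : (ι → Fin 2) → (ι → Fin 2)) : Op ι :=
  Matrix.of fun z w => if z = f w then 1 else 0

theorem permOp_mem_unitaryGroup {f : (ι → Fin 2) → (ι → Fin 2)} (hf : Function.Injective f) :
    permOp f ∈ Matrix.unitaryGroup (ι → Fin 2) ℂ := by
  rw [Matrix.mem_unitaryGroup_iff']
  ext z w
  simp [permOp, Matrix.mul_apply, Matrix.star_apply, Matrix.one_apply, hf.eq_iff, eq_comm]

theorem permOp_mul_apply {f : (ι → Fin 2) → (ι → Fin 2)} (hf : Function.Involutive f)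
    (M : Op ι) (z w : ι → Fin 2) : (permOp f * M) z w = M (f z) w := by
  have h : ∀ y, z = f y ↔ f z = y := fun y => ⟨fun h => by rw [h, hf], fun h => by rw [← h, hf]⟩
  simp [permOp, Matrix.mul_apply, h]

theorem mul_permOp_apply (f : (ι → Fin 2) → (ι → Fin 2)) (M : Op ι) (z w : ι → Fin 2) :
    (M * permOp f) z w = M z (f w) := by
  simp [permOp, Matrix.mul_apply]

theorem sum_glue (F : (ι → Fin 2) → ℂ) :
    ∑ z, F z = ∑ a, ∑ b, F (glue side a b) := by
  rw [← Fintype.sum_prod_type']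
  exact (Fintype.sum_equiv (glueEquiv side) _ _ fun _ => rfl).symm

theorem IsLocalUnitary.mul {M N : Op ι} (hM : IsLocalUnitary side M) (hN : IsLocalUnitary side N) :
    IsLocalUnitary side (M * N) := by
  obtain ⟨a, ha, b, hb, h⟩ := hM
  obtain ⟨a', ha', b', hb', h'⟩ := hN
  refine ⟨a * a', mul_mem ha ha', b * b', mul_mem hb hb', fun x y => ?_⟩
  rw [Matrix.mul_apply, sum_glue (side := side), Matrix.mul_apply, Matrix.mul_apply,
    Finset.sum_mul_sum]
  refine Finset.sum_congr rfl fun u _ => Finset.sum_congr rfl fun v _ => ?_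
  rw [h, h']
  simp only [glue_false, glue_true]
  ring

theorem isLocalUnitary_tensorOp (u : ι → Gate1) : IsLocalUnitary side (tensorOp u) := by
  refine ⟨tensorOp fun k => u k, tensorOp_mem_unitaryGroup _, tensorOp fun k => u k,
    tensorOp_mem_unitaryGroup _, fun x y => ?_⟩
  simp only [tensorOp, Matrix.of_apply]
  rw [← Fintype.prod_subtype_mul_prod_subtype (fun k => side k = false)]
  congr 1
  exact Fintype.prod_equiv (Equiv.subtypeEquivRight fun k => by simp) _ _ fun _ => rfl

theorem isLocalUnitary_one : IsLocalUnitary side (1 : Op ι) := by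
  rw [← tensorOp_one]
  exact isLocalUnitary_tensorOp _

/-- By `hloc` the permutation splits into one map per system; each is read off with the other system
set to the arbitrary reference state 0. -/
theorem isLocalUnitary_permOp {f : (ι → Fin 2) → (ι → Fin 2)} (hf : Function.Injective f)
    (hloc : ∀ z w k, (∀ j, side j = side k → z j = w j) → f z k = f w k) :
    IsLocalUnitary side (permOp f) := by
  have eA : ∀ (z w : ι → Fin 2), (∀ k : {k // side k = false}, z k = w k) →
      ∀ k : {k // side k = false}, f z k = f w k :=
    fun z w h k => hloc z w k fun j hj => h ⟨j, hj.trans k.2⟩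
  have eB : ∀ (z w : ι → Fin 2), (∀ k : {k // side k = true}, z k = w k) →
      ∀ k : {k // side k = true}, f z k = f w k :=
    fun z w h k => hloc z w k fun j hj => h ⟨j, hj.trans k.2⟩
  have ext' : ∀ z w : ι → Fin 2, (∀ k : {k // side k = false}, z k = w k) →
      (∀ k : {k // side k = true}, z k = w k) → z = w := fun z w h₁ h₂ => by
    rw [← glue_restrict (side := side) z, ← glue_restrict (side := side) w, funext h₁, funext h₂]
  refine ⟨permOp fun a k => f (glue side a 0) k, permOp_mem_unitaryGroup fun a a' h => ?_,
    permOp fun b k => f (glue side 0 b) k, permOp_mem_unitaryGroup fun b b' h => ?_,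
    fun x y => ?_⟩
  · have := hf (ext' _ _ (fun k => congrFun h k) (eB (glue side a 0) (glue side a' 0) (by simp)))
    ext k
    rw [← glue_false (side := side) a 0 k, this, glue_false]
  · have := hf (ext' _ _ (eA (glue side 0 b) (glue side 0 b') (by simp)) fun k => congrFun h k)
    ext k
    rw [← glue_true (side := side) 0 b k, this, glue_true]
  · simp only [permOp, Matrix.of_apply, ← ite_and, mul_ite, mul_one, mul_zero]
    refine if_congr ⟨?_, fun h => ?_⟩ rfl rfl
    · rintro rfl
      exact ⟨funext (eB _ _ (by simp)), funext (eA _ _ (by simp))⟩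
    · exact ext' _ _ (fun k => (congrFun h.2 k).trans (eA _ _ (by simp) k))
        fun k => (congrFun h.1 k).trans (eB _ _ (by simp) k)

end Registers

/-! ### Realignment and operator Schmidt rank -/

section Rank

theorem rank_add_le {m n : Type} [Fintype m] [Fintype n] (A B : Matrix m n ℂ) :
    (A + B).rank ≤ A.rank + B.rank := by
  unfold Matrix.rank
  refine le_trans (Submodule.finrank_mono ?_) (Submodule.finrank_add_le_finrank_add_finrank _ _)
  rintro _ ⟨v, rfl⟩
  simp only [Matrix.mulVecLin_apply, Matrix.add_mulVec]
  exact Submodule.add_mem_sup ⟨v, rfl⟩ ⟨v, rfl⟩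

/-- Stacking arbitrary vectors of the range of S, one per block, lands in the range of N: rescale
preimages by the inverse of f. -/
theorem card_mul_rank_le_rank_of_blocks {κ m n : Type} [Fintype κ] [DecidableEq κ] [Fintype m]
    [Fintype n] (S : Matrix m n ℂ) (N : Matrix (κ × m) (κ × n) ℂ) (f : κ → ℂ) (hf : ∀ k, f k ≠ 0)
    (hN : ∀ k i l j, N (k, i) (l, j) = if k = l then f k * S i j else 0) :
    Fintype.card κ * S.rank ≤ N.rank := by
  unfold Matrix.rank
  rw [← smul_eq_mul, ← Finset.card_univ, ← Finset.sum_const, ← Module.finrank_pi_fintype (R := ℂ)]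
  have hmem : ∀ g : κ → LinearMap.range S.mulVecLin,
      (fun p : κ × m => (g p.1).1 p.2) ∈ LinearMap.range N.mulVecLin := by
    intro g
    choose v hv using fun k => (g k).2
    refine ⟨fun p => (f p.1)⁻¹ * v p.1 p.2, ?_⟩
    ext ⟨k, i⟩
    simp only [Matrix.mulVecLin_apply, Matrix.mulVec, dotProduct, Fintype.sum_prod_type, hN,
      ite_mul, zero_mul, Finset.sum_ite_irrel, Finset.sum_const_zero, Finset.sum_ite_eq,
      Finset.mem_univ, if_true, ← hv k]
    refine Finset.sum_congr rfl fun j _ => ?_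
    have := hf k
    field_simp
  let φ : (κ → LinearMap.range S.mulVecLin) →ₗ[ℂ] LinearMap.range N.mulVecLin :=
    { toFun := fun g => ⟨_, hmem g⟩
      map_add' := fun _ _ => rfl
      map_smul' := fun _ _ => rfl }
  refine LinearMap.finrank_le_finrank_of_injective (f := φ) fun g g' h => ?_
  ext k i
  exact congrFun (congrArg Subtype.val h) (k, i)

variable {ι : Type} [Fintype ι] [DecidableEq ι]

/-- The realignment of an operator with respect to the bipartition; its rank is the operator
Schmidt rank. -/
def realign (side : ι → Bool) (M : Op ι) :
    Matrix (({k // side k = false} → Fin 2) × ({k // side k = false} → Fin 2))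
      (({k // side k = true} → Fin 2) × ({k // side k = true} → Fin 2)) ℂ :=
  Matrix.of fun p r => M (glue side p.1 r.1) (glue side p.2 r.2)

/-- Realignment turns the A factors of L and K into a Kronecker factor on the left and the B factors
into one on the right, so the rank cannot grow. -/
theorem rank_realign_mul_mul_le {side : ι → Bool} {L K : Op ι} (hL : IsLocalUnitary side L)
    (hK : IsLocalUnitary side K) (M : Op ι) :
    (realign side (L * M * K)).rank ≤ (realign side M).rank := by
  obtain ⟨a, -, b, -, h⟩ := hL
  obtain ⟨a', -, b', -, h'⟩ := hK
  have key : realign side (L * M * K) =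
      Matrix.kronecker a a'ᵀ * realign side M * Matrix.kronecker bᵀ b' := by
    ext ⟨zA, wA⟩ ⟨zB, wB⟩
    simp only [realign, Matrix.mul_apply, Matrix.of_apply, sum_glue (side := side), h, h',
      Matrix.kronecker, Matrix.kroneckerMap_apply, Matrix.transpose_apply,
      glue_false, glue_true, Fintype.sum_prod_type, Finset.sum_mul]
    refine Finset.sum_comm.trans (Eq.trans ?_ Finset.sum_comm)
    refine Finset.sum_congr rfl fun vB _ => ?_
    refine Finset.sum_comm.trans (Eq.trans ?_ Finset.sum_comm)
    refine Finset.sum_congr rfl fun uA _ => ?_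
    refine Finset.sum_comm.trans ?_
    refine Finset.sum_congr rfl fun uB _ => Finset.sum_congr rfl fun vA _ => ?_
    ring
  rw [key]
  exact (Matrix.rank_mul_le_left _ _).trans (Matrix.rank_mul_le_right _ _)

end Rank

/-! ### Single-qubit gates -/

theorem IsDiagOrAntidiag.eq_add_of_ne_zero {u : Matrix (Fin 2) (Fin 2) ℂ}
    (h : IsDiagOrAntidiag u) : ∃ d : Fin 2, ∀ i j, u i j ≠ 0 → i = j + d := by
  rcases h with ⟨h₁, h₂⟩ | ⟨h₁, h₂⟩
  · refine ⟨0, fun i j hij => ?_⟩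
    fin_cases i <;> fin_cases j <;> simp_all
  · refine ⟨1, fun i j hij => ?_⟩
    fin_cases i <;> fin_cases j <;> simp_all

/-- A vanishing entry at the only allowed position would give a zero column, contrary to unitarity.
-/
theorem exists_apply_eq_ite {u : Gate1} (h : IsDiagOrAntidiag u.1) :
    ∃ (d : Fin 2) (c : Fin 2 → ℂ), (∀ j, c j ≠ 0) ∧ ∀ i j, u.1 i j = if i = j + d then c j else 0 := by
  obtain ⟨d, hd⟩ := h.eq_add_of_ne_zero
  refine ⟨d, fun j => u.1 (j + d) j, fun j hj => ?_, fun i j => ?_⟩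
  · have h₁ : (star u.1 * u.1) j j = 1 := by
      rw [Matrix.mem_unitaryGroup_iff'.1 u.2, Matrix.one_apply_eq]
    rw [Matrix.mul_apply, Finset.sum_eq_zero] at h₁
    · exact zero_ne_one h₁
    · intro i _
      by_cases hi : u.1 i j = 0
      · rw [hi, mul_zero]
      · exact absurd (hd i j hi ▸ hj) hi
  · split_ifs with hij
    · rw [hij]
    · exact not_not.1 fun h' => hij (hd i j h')

theorem hadamard_apply (i j : Fin 2) :
    hadamard i j = ((Real.sqrt 2 : ℝ) : ℂ)⁻¹ * (-1) ^ ((i : ℕ) * (j : ℕ)) := by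
  fin_cases i <;> fin_cases j <;> simp [hadamard]

theorem sum_neg_one_pow_eq_zero {a b : Fin 2} (h : a ≠ b) :
    ∑ i : Fin 2, (-1 : ℂ) ^ ((a : ℕ) * (i : ℕ)) * (-1) ^ ((i : ℕ) * (b : ℕ)) = 0 := by
  fin_cases a <;> fin_cases b <;> simp_all

theorem sum_sum_neg_one_pow_ne_zero (a b : Fin 2) :
    ∑ i : Fin 2, ∑ j : Fin 2, (-1 : ℂ) ^ ((a : ℕ) * (i : ℕ)) * (-1) ^ ((b : ℕ) * (j : ℕ)) *
      (-1) ^ ((i : ℕ) * (j : ℕ)) ≠ 0 := by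
  fin_cases a <;> fin_cases b <;> norm_num

namespace Layer

variable {Q : Type} {ℓ : Layer Q} {side : Q → Bool} {q r : Q}

/-- Along a path through the intermediate bit u, the phases of P cancel and the two Hadamard signs
multiply. The flips of D₁ and D₂ combine into d. This sign formula is all that is used of an H-type
unit. -/
theorem IsHTypeUnit.exists_mul_apply_eq (h : ℓ.IsHTypeUnit side q) :
    ∃ (d : Fin 2) (c : Fin 2 → Fin 2 → ℂ), (∀ i k, c i k ≠ 0) ∧ ∀ i k u,
      (ℓ.post q).1 i u * (ℓ.pre q).1 u k =
        c i k * (-1) ^ (((i + k + d : Fin 2) : ℕ) * (u : ℕ)) := by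
  obtain ⟨-, P, D₁, D₂, hP, h₁, h₂, hpre, hpost⟩ := h
  obtain ⟨d₁, c₁, hc₁, h₁⟩ := exists_apply_eq_ite h₁
  obtain ⟨d₂, c₂, hc₂, h₂⟩ := exists_apply_eq_ite h₂
  have hs : ((Real.sqrt 2 : ℝ) : ℂ)⁻¹ ≠ 0 := by simp
  have hPP : ∀ u, star (P.1 u u) * P.1 u u = 1 := fun u => by
    have : (star P.1 * P.1) u u = 1 := by
      rw [Matrix.mem_unitaryGroup_iff'.1 P.2, Matrix.one_apply_eq]
    rw [← this, Matrix.mul_apply, Fin.sum_univ_two, Matrix.star_apply, Matrix.star_apply]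
    fin_cases u <;> simp [hP.1, hP.2]
  have e₁ : ∀ u k, (ℓ.pre q).1 u k = P.1 u u * hadamard u (k + d₁) * c₁ k := fun u k => by
    simp only [hpre, Matrix.mul_apply, h₁, mul_ite, mul_zero, Finset.sum_ite_eq',
      Finset.mem_univ, if_true]
    fin_cases u <;> simp [hP.1, hP.2]
  have e₂ : ∀ i u, (ℓ.post q).1 i u = c₂ (i + d₂) * hadamard (i + d₂) u * star (P.1 u u) :=
    fun i u => by
      have hi : ∀ j, i = j + d₂ ↔ j = i + d₂ := by clear h₂; revert i d₂; decide
      have hadd : i + d₂ + d₂ = i := by clear h₂ hi; revert i d₂; decide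
      simp only [hpost, Matrix.mul_apply, h₂, hi, ite_mul, zero_mul, Finset.sum_ite_eq',
        Finset.mem_univ, if_true, Matrix.UnitaryGroup.inv_val,
        Matrix.star_apply]
      fin_cases u <;> simp [hP.1, hP.2]
  refine ⟨d₁ + d₂, fun i k => c₂ (i + d₂) * c₁ k * (((Real.sqrt 2 : ℝ) : ℂ)⁻¹) ^ 2,
    fun i k => mul_ne_zero (mul_ne_zero (hc₂ _) (hc₁ _)) (pow_ne_zero _ hs), fun i k u => ?_⟩
  have hsign : (-1 : ℂ) ^ (((i + k + (d₁ + d₂) : Fin 2) : ℕ) * (u : ℕ)) =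
      (-1) ^ (((i + d₂ : Fin 2) : ℕ) * (u : ℕ)) * (-1) ^ ((u : ℕ) * ((k + d₁ : Fin 2) : ℕ)) := by
    fin_cases i <;> fin_cases k <;> fin_cases d₁ <;> fin_cases d₂ <;> fin_cases u <;> simp
  rw [e₁, e₂, hadamard_apply, hadamard_apply, hsign]
  linear_combination (c₂ (i + d₂) * c₁ k * (((Real.sqrt 2 : ℝ) : ℂ)⁻¹) ^ 2 *
    (-1) ^ (((i + d₂ : Fin 2) : ℕ) * (u : ℕ)) * (-1) ^ ((u : ℕ) * ((k + d₁ : Fin 2) : ℕ))) * hPP u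

theorem IsGlobalCZ.ne (h : ℓ.IsGlobalCZ side q r) : q ≠ r := fun e => h.2.2 (by rw [e])

/-! ### Matrix elements of a layer -/

variable [Fintype Q] [DecidableEq Q]

/-- The eigenvalue of the control-phase gate `e` on the basis state `u`. -/
def gatePhase (ℓ : Layer Q) (e : Sym2 Q) (u : Q → Fin 2) : ℂ :=
  if ∀ q ∈ e, u q = 1 then Complex.exp (Complex.I * (ℓ.phase e : ℂ)) else 1

theorem gatePhase_update_of_notMem {e : Sym2 Q} (h : q ∉ e) (u : Q → Fin 2) (i : Fin 2) :
    ℓ.gatePhase e (Function.update u q i) = ℓ.gatePhase e u := by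
  unfold gatePhase
  congr 1
  refine propext (forall₂_congr fun p hp => ?_)
  rw [Function.update_of_ne (fun hpq : p = q => h (hpq ▸ hp))]

theorem gatePhase_of_isCZ (h : Complex.exp (Complex.I * (ℓ.phase s(q, r) : ℂ)) = -1)
    (u : Q → Fin 2) : ℓ.gatePhase s(q, r) u = (-1) ^ ((u q : ℕ) * (u r : ℕ)) := by
  unfold gatePhase
  simp only [Sym2.mem_iff, forall_eq_or_imp, forall_eq, h]
  generalize u q = i
  generalize u r = j
  fin_cases i <;> fin_cases j <;> simp

/-- The eigenvalue of the control-phase gates other than the one on `{q, r}`. -/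
def otherPhase (ℓ : Layer Q) (q r : Q) (u : Q → Fin 2) : ℂ :=
  ∏ e ∈ ℓ.gates.erase s(q, r), ℓ.gatePhase e u

theorem otherPhase_update (h : s(q, r) ∈ ℓ.gates) {p : Q} (hp : p ∈ s(q, r)) (u : Q → Fin 2)
    (i : Fin 2) : ℓ.otherPhase q r (Function.update u p i) = ℓ.otherPhase q r u :=
  Finset.prod_congr rfl fun e he => gatePhase_update_of_notMem
    (fun hpe => (Finset.mem_erase.1 he).1
      (ℓ.disjoint e (Finset.mem_erase.1 he).2 _ h p hpe hp)) u i

theorem prod_gatePhase_eq (h : ℓ.IsGlobalCZ side q r) (u : Q → Fin 2) :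
    ∏ e ∈ ℓ.gates, ℓ.gatePhase e u =
      (-1) ^ ((u q : ℕ) * (u r : ℕ)) * ℓ.otherPhase q r u := by
  rw [otherPhase, ← gatePhase_of_isCZ h.2.1]
  exact (Finset.mul_prod_erase ℓ.gates (fun e => ℓ.gatePhase e u) h.1).symm

theorem op_apply (x y : Q → Fin 2) :
    ℓ.op x y = ∑ u : Q → Fin 2, (∏ p, (ℓ.post p).1 (x p) (u p) * (ℓ.pre p).1 (u p) (y p)) *
      ∏ e ∈ ℓ.gates, ℓ.gatePhase e u := by
  rw [op, controlPhases, Matrix.mul_apply]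
  refine Finset.sum_congr rfl fun u _ => ?_
  rw [Matrix.mul_diagonal]
  simp only [tensorOp, gatePhase, Matrix.of_apply, Finset.prod_mul_distrib]
  ring

/-- Each state is reached twice: from itself and from its flip at q. This lets one bit be summed out
without changing the index type. -/
theorem two_mul_sum_eq_sum_update (q : Q) (F : (Q → Fin 2) → ℂ) :
    2 * ∑ u, F u = ∑ u, ∑ i, F (Function.update u q i) := by
  have hinv : Function.Involutive fun u : Q → Fin 2 => Function.update u q (u q + 1) := by
    intro u
    have : u q + 1 + 1 = u q := by generalize u q = i; revert i; decide
    simp [this]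
  have h : ∀ u : Q → Fin 2,
      ∑ i, F (Function.update u q i) = F u + F (Function.update u q (u q + 1)) := by
    intro u
    conv_rhs => rw [← Function.update_eq_self q u]
    simp only [Function.update_idem, Function.update_self]
    generalize u q = i
    fin_cases i
    · simp
    · simp [add_comm]
  simp only [h, Finset.sum_add_distrib]
  rw [two_mul, ← Equiv.sum_comp hinv.toPerm F]
  simp only [Function.Involutive.coe_toPerm]


theorem prod_update_eq (w : Q → Fin 2 → ℂ) (u : Q → Fin 2) (i : Fin 2) :
    ∏ p, w p (Function.update u q i p) = w q i * ∏ p ∈ Finset.univ.erase q, w p (u p) := by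
  rw [← Finset.mul_prod_erase _ _ (Finset.mem_univ q), Function.update_self]
  congr 1
  exact Finset.prod_congr rfl fun p hp => by rw [Function.update_of_ne (Finset.ne_of_mem_erase hp)]

theorem op_apply_eq_zero {x y : Q → Fin 2}
    (h : ∀ u : Q → Fin 2,
      (∀ p, p ≠ q → (ℓ.post p).1 (x p) (u p) ≠ 0) →
      ∑ i, (ℓ.post q).1 (x q) i * (ℓ.pre q).1 i (y q) *
        ∏ e ∈ ℓ.gates, ℓ.gatePhase e (Function.update u q i) = 0) :
    ℓ.op x y = 0 := by
  have key : 2 * ℓ.op x y = 0 := by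
    rw [op_apply, two_mul_sum_eq_sum_update q]
    refine Finset.sum_eq_zero fun u _ => ?_
    simp only [prod_update_eq fun p j => (ℓ.post p).1 (x p) j * (ℓ.pre p).1 j (y p)]
    by_cases hu : ∀ p, p ≠ q → (ℓ.post p).1 (x p) (u p) ≠ 0
    · rw [← mul_zero (∏ p ∈ Finset.univ.erase q,
        (ℓ.post p).1 (x p) (u p) * (ℓ.pre p).1 (u p) (y p)), ← h u hu, Finset.mul_sum]
      exact Finset.sum_congr rfl fun i _ => by ring
    · push Not at hu
      obtain ⟨p, hp, h₀⟩ := hu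
      have : ∏ p ∈ Finset.univ.erase q,
          (ℓ.post p).1 (x p) (u p) * (ℓ.pre p).1 (u p) (y p) = 0 :=
        Finset.prod_eq_zero (Finset.mem_erase.2 ⟨hp, Finset.mem_univ p⟩) (by rw [h₀, zero_mul])
      simp [this]
  simpa using key

theorem IsIdleUnit.exists_parity (h : ℓ.IsIdleUnit q) :
    ∃ d : Fin 2, ∀ x y, ℓ.op x y ≠ 0 → x q = y q + d := by
  obtain ⟨d, hd⟩ := h.2.eq_add_of_ne_zero
  refine ⟨d, fun x y hxy => hd _ _ fun h₀ => hxy (op_apply_eq_zero (q := q) fun u _ => ?_)⟩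
  have hph : ∀ i, ∏ e ∈ ℓ.gates, ℓ.gatePhase e (Function.update u q i) =
      ∏ e ∈ ℓ.gates, ℓ.gatePhase e u := fun i =>
    Finset.prod_congr rfl fun e he => gatePhase_update_of_notMem (fun hq => h.1 ⟨e, he, hq⟩) u i
  simp only [hph]
  rw [← Finset.sum_mul, ← Matrix.mul_apply, h₀, zero_mul]

/-- H C_Z H is a control-X. With no gate after the control-Z on r, the intermediate bit of r is its
output bit, and summing over the intermediate bit of q is a character sum that vanishes unless the
parities match. -/
theorem exists_parity_of_isGlobalCZ {d : Fin 2} {c : Fin 2 → Fin 2 → ℂ}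
    (hpp : ∀ i k u, (ℓ.post q).1 i u * (ℓ.pre q).1 u k =
        c i k * (-1) ^ (((i + k + d : Fin 2) : ℕ) * (u : ℕ)))
    (hcz : ℓ.IsGlobalCZ side q r) (hr : ℓ.post r = 1) {x y : Q → Fin 2} (hxy : ℓ.op x y ≠ 0) :
    x q = y q + (d + x r) := by
  by_contra hne
  refine hxy (op_apply_eq_zero (q := q) fun u hu => ?_)
  have hur : u r = x r := by
    by_contra h
    refine hu r hcz.ne.symm ?_
    rw [hr, Matrix.UnitaryGroup.one_val, Matrix.one_apply_ne (Ne.symm h)]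
  have hab : x q + y q + d ≠ x r := by
    revert hne
    generalize x q = a; generalize y q = b; generalize x r = e
    clear hpp
    revert a b e d
    decide
  simp only [prod_gatePhase_eq hcz, otherPhase_update hcz.1 (Sym2.mem_mk_left q r),
    Function.update_self, Function.update_of_ne hcz.ne.symm, hpp, hur]
  calc _ = c (x q) (y q) * ℓ.otherPhase q r u *
        ∑ i : Fin 2, (-1 : ℂ) ^ (((x q + y q + d : Fin 2) : ℕ) * (i : ℕ)) *
          (-1) ^ ((i : ℕ) * (x r : ℕ)) := by
        rw [Finset.mul_sum]
        exact Finset.sum_congr rfl fun i _ => by ring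
    _ = 0 := by rw [sum_neg_one_pow_eq_zero hab, mul_zero]

/-- The factor of the matrix elements of a layer on the qubits other than `q` and `r`. -/
def restCoeff (ℓ : Layer Q) (q r : Q) (x y : Q → Fin 2) : ℂ :=
  4⁻¹ * ∑ u : Q → Fin 2, (∏ p ∈ (Finset.univ.erase q).erase r,
    (ℓ.post p).1 (x p) (u p) * (ℓ.pre p).1 (u p) (y p)) * ℓ.otherPhase q r u

theorem restCoeff_congr {x y x' y' : Q → Fin 2} (hx : ∀ p, p ≠ q → p ≠ r → x p = x' p)
    (hy : ∀ p, p ≠ q → p ≠ r → y p = y' p) : ℓ.restCoeff q r x y = ℓ.restCoeff q r x' y' := by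
  unfold restCoeff
  congr 1
  refine Finset.sum_congr rfl fun u _ => ?_
  congr 1
  refine Finset.prod_congr rfl fun p hp => ?_
  simp only [Finset.mem_erase] at hp
  rw [hx p hp.2.1 hp.1, hy p hp.2.1 hp.1]

/-- No other gate touches q or r, so the layer factorises. The 4⁻¹ in `restCoeff` compensates its
sum over whole-register states, whose bits at q and r are irrelevant. -/
theorem op_apply_eq_mul_restCoeff (h : ℓ.IsGlobalCZ side q r) (x y : Q → Fin 2) :
    ℓ.op x y = (∑ i : Fin 2, ∑ j : Fin 2,
      ((ℓ.post q).1 (x q) i * (ℓ.pre q).1 i (y q)) * ((ℓ.post r).1 (x r) j * (ℓ.pre r).1 j (y r)) *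
        (-1) ^ ((i : ℕ) * (j : ℕ))) * ℓ.restCoeff q r x y := by
  have key : 2 * (2 * ℓ.op x y) = ∑ u : Q → Fin 2, ∑ j : Fin 2, ∑ i : Fin 2,
      ((ℓ.post q).1 (x q) i * (ℓ.pre q).1 i (y q)) * ((ℓ.post r).1 (x r) j * (ℓ.pre r).1 j (y r)) *
        (-1) ^ ((i : ℕ) * (j : ℕ)) * ((∏ p ∈ (Finset.univ.erase q).erase r,
    (ℓ.post p).1 (x p) (u p) * (ℓ.pre p).1 (u p) (y p)) * ℓ.otherPhase q r u) := by
    rw [op_apply, two_mul_sum_eq_sum_update q, two_mul_sum_eq_sum_update r]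
    refine Finset.sum_congr rfl fun u _ => Finset.sum_congr rfl fun j _ =>
      Finset.sum_congr rfl fun i _ => ?_
    rw [prod_update_eq fun p j => (ℓ.post p).1 (x p) j * (ℓ.pre p).1 j (y p),
      ← Finset.mul_prod_erase _ _ (Finset.mem_erase.2 ⟨h.ne.symm, Finset.mem_univ r⟩),
      prod_gatePhase_eq h, otherPhase_update h.1 (Sym2.mem_mk_left q r),
      otherPhase_update h.1 (Sym2.mem_mk_right q r), Function.update_self,
      Function.update_of_ne h.ne.symm]
    simp only [Function.update_self]
    have : ∏ p ∈ (Finset.univ.erase q).erase r, (ℓ.post p).1 (x p) (Function.update u r j p) *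
          (ℓ.pre p).1 (Function.update u r j p) (y p) =
        ∏ p ∈ (Finset.univ.erase q).erase r,
          (ℓ.post p).1 (x p) (u p) * (ℓ.pre p).1 (u p) (y p) :=
      Finset.prod_congr rfl fun p hp => by
        rw [Function.update_of_ne (Finset.ne_of_mem_erase hp)]
    rw [this]
    ring
  have h4 : ℓ.op x y = 4⁻¹ * (2 * (2 * ℓ.op x y)) := by ring
  rw [h4, key, restCoeff, mul_left_comm]
  congr 1
  rw [Finset.mul_sum]
  refine Finset.sum_congr rfl fun u _ => ?_
  rw [Finset.sum_comm]
  simp only [Finset.sum_mul]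

theorem op_ne_zero (ℓ : Layer Q) : ℓ.op ≠ 0 := by
  intro h
  have hc : ℓ.controlPhases = 0 := by
    calc ℓ.controlPhases = (tensorOp ℓ.post⁻¹ * tensorOp ℓ.post) * ℓ.controlPhases *
          (tensorOp ℓ.pre * tensorOp ℓ.pre⁻¹) := by
            rw [tensorOp_inv_mul, tensorOp_mul_inv, one_mul, mul_one]
      _ = tensorOp ℓ.post⁻¹ * ℓ.op * tensorOp ℓ.pre⁻¹ := by simp only [op, mul_assoc]
      _ = 0 := by rw [h, mul_zero, zero_mul]
  have := congrFun (congrFun hc 0) 0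
  simp only [controlPhases, Matrix.diagonal_apply_eq, Matrix.zero_apply, Finset.prod_eq_zero_iff] at this
  obtain ⟨e, -, he⟩ := this
  split_ifs at he
  · exact Complex.exp_ne_zero _ he
  · exact one_ne_zero he

end Layer

/-! ### Packing processes -/

section Packing

variable {Q E : Type} {root : E → Q}

theorem involutive_sumElim_add (sh : E → (Q → Fin 2) → Fin 2) :
    Function.Involutive fun w : Q ⊕ E → Fin 2 => Sum.elim (fun q => w (Sum.inl q))
      fun e => w (Sum.inr e) + sh e fun q => w (Sum.inl q) := by
  intro w
  have h : ∀ a b : Fin 2, a + b + b = a := by decide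
  ext (q | e)
  · rfl
  · simp [h]

variable [Fintype Q] [Fintype E] [DecidableEq E]

theorem tensorOp_sumElim_one (g : Q → Gate1) :
    tensorOp (Sum.elim g (1 : E → Gate1)) = liftOp (tensorOp g) := by
  ext z w
  simp only [tensorOp, liftOp, Matrix.of_apply, Fintype.prod_sum_type, Sum.elim_inl, Sum.elim_inr,
    Pi.one_apply, Matrix.UnitaryGroup.one_val, prod_one_apply fun e => z (Sum.inr e), funext_iff,
    mul_ite, mul_one, mul_zero]

variable [DecidableEq Q]

theorem controlXs_eq_permOp (root : E → Q) :
    controlXs root = permOp fun w => Sum.elim (fun q => w (Sum.inl q))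
      fun e => w (Sum.inr e) + w (Sum.inl (root e)) := by
  ext z w
  simp only [controlXs, permOp, Matrix.of_apply, funext_iff, Sum.forall, Sum.elim_inl,
    Sum.elim_inr]

theorem krausOp_apply (s : E → Fin 2) (K : Op (Q ⊕ E)) (x x' : Q → Fin 2) :
    krausOp root s K x x' = ∑ y : E → Fin 2, (∏ e, (-1 : ℂ) ^ ((s e : ℕ) * (y e : ℕ))) *
      K (Sum.elim x fun e => y e + x (root e)) (Sum.elim x' fun e => x' (root e)) := by
  simp only [krausOp, Matrix.of_apply, controlXs_eq_permOp]
  refine Finset.sum_congr rfl fun y _ => ?_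
  rw [mul_permOp_apply, permOp_mul_apply (involutive_sumElim_add fun e x => x (root e))]
  simp

theorem sum_prod_neg_one_pow (y y' : E → Fin 2) :
    ∑ s : E → Fin 2, (∏ e, (-1 : ℂ) ^ ((s e : ℕ) * (y' e : ℕ))) *
      (∏ e, (-1 : ℂ) ^ ((s e : ℕ) * (y e : ℕ))) = if y = y' then 2 ^ Fintype.card E else 0 := by
  have h : ∀ a b : Fin 2, ∑ i : Fin 2, (-1 : ℂ) ^ ((i : ℕ) * (b : ℕ)) * (-1) ^ ((i : ℕ) * (a : ℕ)) =
      if a = b then 2 else 0 := by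
    intro a b
    fin_cases a <;> fin_cases b <;> norm_num
  simp only [← Finset.prod_mul_distrib]
  rw [← Fintype.piFinset_univ, ← Finset.prod_univ_sum (fun _ => Finset.univ)
    fun e (i : Fin 2) => (-1 : ℂ) ^ ((i : ℕ) * (y' e : ℕ)) * (-1) ^ ((i : ℕ) * (y e : ℕ))]
  simp only [h, Finset.prod_ite_zero, Finset.mem_univ, true_implies, Finset.prod_const,
    Finset.card_univ, funext_iff]

/-- The Kraus operators are the Fourier transform over (ℤ/2)^E of the kernel's blocks indexed by the
mismatch y between auxiliary bits and root bits. Being constant in s means being supported at y = 0.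
-/
theorem packsTo_iff {K : Op (Q ⊕ E)} {U : Op Q} :
    PacksTo root K U ↔ ∀ (x x' : Q → Fin 2) (y : E → Fin 2),
      K (Sum.elim x fun e => y e + x (root e)) (Sum.elim x' fun e => x' (root e)) =
        if y = 0 then U x x' else 0 := by
  refine ⟨fun h x x' y => ?_, fun h s => ?_⟩
  · have hU : ∀ s : E → Fin 2, krausOp root s K x x' =
        (∏ e, (-1 : ℂ) ^ ((s e : ℕ) * ((0 : E → Fin 2) e : ℕ))) * U x x' := fun s => by
      rw [h s]
      simp
    have h₂ : (2 : ℂ) ^ Fintype.card E ≠ 0 := pow_ne_zero _ two_ne_zero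
    have e₁ : ∑ s : E → Fin 2, (∏ e, (-1 : ℂ) ^ ((s e : ℕ) * (y e : ℕ))) * krausOp root s K x x' =
        2 ^ Fintype.card E *
          K (Sum.elim x fun e => y e + x (root e)) (Sum.elim x' fun e => x' (root e)) := by
      simp only [krausOp_apply, Finset.mul_sum]
      rw [Finset.sum_comm]
      simp only [← mul_assoc, ← Finset.sum_mul, sum_prod_neg_one_pow, ite_mul, zero_mul,
        Finset.sum_ite_eq', Finset.mem_univ, if_true]
    simp only [hU, ← mul_assoc, ← Finset.sum_mul, sum_prod_neg_one_pow] at e₁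
    refine mul_left_cancel₀ h₂ (e₁.symm.trans ?_)
    by_cases hy : y = 0
    · simp [hy]
    · simp [hy, Ne.symm hy]
  · ext x x'
    simp [krausOp_apply, h]

theorem PacksTo.apply {K : Op (Q ⊕ E)} {U : Op Q} (h : PacksTo root K U) (z w : Q ⊕ E → Fin 2)
    (hw : ∀ e, w (Sum.inr e) = w (Sum.inl (root e))) :
    K z w = if ∀ e, z (Sum.inr e) = z (Sum.inl (root e)) then
      U (fun q => z (Sum.inl q)) (fun q => w (Sum.inl q)) else 0 := by
  have h₁ : ∀ a b : Fin 2, a + b + b = a := by decide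
  have h₂ : ∀ a b : Fin 2, a + b = 0 ↔ a = b := by decide
  have := packsTo_iff.1 h (fun q => z (Sum.inl q)) (fun q => w (Sum.inl q))
    fun e => z (Sum.inr e) + z (Sum.inl (root e))
  simp only [h₁, funext_iff, Pi.zero_apply, h₂] at this
  rw [← this]
  congr 1
  · ext (q | e) <;> rfl
  · ext (q | e)
    · rfl
    · exact congrArg Fin.val (hw e)

theorem liftOp_mul_apply (G : Op Q) (N : Op (Q ⊕ E)) (z w : Q ⊕ E → Fin 2) :
    (liftOp G * N : Op (Q ⊕ E)) z w = ∑ u, G (fun q => z (Sum.inl q)) u *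
      N (Sum.elim u fun e => z (Sum.inr e)) w := by
  rw [Matrix.mul_apply, ← (Equiv.sumArrowEquivProdArrow Q E (Fin 2)).symm.sum_comp,
    Fintype.sum_prod_type]
  refine Finset.sum_congr rfl fun u _ => ?_
  have h : ∀ y : E → Fin 2, (∀ e, z (Sum.inr e) = y e) ↔ y = fun e => z (Sum.inr e) :=
    fun y => by rw [funext_iff]; exact forall_congr' fun e => eq_comm
  simp [liftOp, Equiv.sumArrowEquivProdArrow, h]

theorem liftOp_mul (G V : Op Q) : (liftOp (G * V) : Op (Q ⊕ E)) = liftOp G * liftOp V := by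
  ext z w
  rw [liftOp_mul_apply]
  by_cases h : ∀ e, z (Sum.inr e) = w (Sum.inr e) <;> simp [liftOp, h, Matrix.mul_apply]

end Packing

/-! ### Joint embedding rules of idle and global `H`-type units -/

section Units

variable {Q E : Type} [Fintype Q] [DecidableEq Q] [Fintype E] [DecidableEq E] {side : Q → Bool}
  {root : E → Q} {ℓ : Layer Q}

theorem hasJointEmbeddingRule_of_units
    (h : ∀ e, ℓ.IsIdleUnit (root e) ∨ ℓ.IsHTypeUnit side (root e))
    (hno : ∀ e e', ¬ ℓ.IsGlobalCZ side (root e) (root e')) :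
    HasJointEmbeddingRule side root ℓ.op := by
  classical
  -- The gates following the control-Z on the partner qubits; stripped of them, the layer's output
  -- still shows each control bit.
  let g : Q → Gate1 := fun p => if ∃ e, ℓ.IsGlobalCZ side (root e) p then ℓ.post p else 1
  let ℓ' : Layer Q := { ℓ with post := g⁻¹ * ℓ.post }
  have hg : ∀ e, g (root e) = 1 := fun e => if_neg fun ⟨e', he'⟩ => hno e' e he'
  have hop : ℓ.op = tensorOp g * ℓ'.op := by
    change _ = tensorOp g * (tensorOp (g⁻¹ * ℓ.post) * ℓ.controlPhases * tensorOp ℓ.pre)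
    rw [← mul_assoc, ← mul_assoc, tensorOp_mul, mul_inv_cancel_left]
    rfl
  have hpost : ∀ e, ℓ'.post (root e) = ℓ.post (root e) := fun e => by simp [ℓ', hg]
  -- The flip of each root must be a function of the system opposite to it, so that the correction
  -- of its auxiliary qubit is local.
  have hparity : ∀ e, ∃ sh : (Q → Fin 2) → Fin 2,
      (∀ x y, (∀ q, side q = !side (root e) → x q = y q) → sh x = sh y) ∧
        ∀ x y, ℓ'.op x y ≠ 0 → x (root e) = y (root e) + sh x := by
    intro e
    rcases h e with hi | hh
    · have : ℓ'.IsIdleUnit (root e) := ⟨hi.1, by rw [hpost]; exact hi.2⟩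
      obtain ⟨d, hd⟩ := this.exists_parity
      exact ⟨fun _ => d, fun _ _ _ => rfl, hd⟩
    · obtain ⟨d, c, -, hc⟩ := hh.exists_mul_apply_eq
      obtain ⟨r, hr⟩ := hh.1
      refine ⟨fun x => d + x r, fun x y hxy => ?_, fun x y hne => ?_⟩
      · refine congrArg (d + ·) (hxy r ?_)
        have := hr.2.2
        revert this
        cases side (root e) <;> cases side r <;> simp
      · refine Layer.exists_parity_of_isGlobalCZ (ℓ := ℓ') (side := side) (c := c) (fun i k u => ?_)
          hr ?_ hne
        · rw [hpost]
          exact hc i k u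
        · have : g r = ℓ.post r := if_pos ⟨e, hr⟩
          simp [ℓ', this]
  choose sh hloc hsh using hparity
  have hinv := involutive_sumElim_add sh
  refine ⟨tensorOp (Sum.elim g 1) * permOp _ * tensorOp (Sum.elim g 1)⁻¹, 1,
    ((isLocalUnitary_tensorOp _).mul (isLocalUnitary_permOp hinv.injective ?_)).mul
      (isLocalUnitary_tensorOp _), isLocalUnitary_one, ?_⟩
  · rintro z w (q | e) hzw
    · exact hzw _ rfl
    · exact congrArg₂ (· + ·) (hzw _ rfl) (hloc e _ _ fun q hq => hzw (Sum.inl q) hq)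
  · have hL : tensorOp (Sum.elim g 1) * permOp (fun w : Q ⊕ E → Fin 2 =>
          Sum.elim (fun q => w (Sum.inl q)) fun e => w (Sum.inr e) + sh e fun q => w (Sum.inl q)) *
        tensorOp (Sum.elim g 1)⁻¹ * liftOp ℓ.op * 1 =
        liftOp (tensorOp g) * (permOp (fun w => Sum.elim (fun q => w (Sum.inl q))
          fun e => w (Sum.inr e) + sh e fun q => w (Sum.inl q)) * liftOp ℓ'.op) := by
      rw [hop, liftOp_mul, ← tensorOp_sumElim_one, mul_one, mul_assoc, mul_assoc,
        ← mul_assoc (tensorOp _⁻¹), tensorOp_inv_mul, one_mul]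
    rw [hL, packsTo_iff]
    intro x x' y
    rw [liftOp_mul_apply, hop, Matrix.mul_apply]
    have hterm : ∀ u, tensorOp g x u * (permOp (fun w => Sum.elim (fun q => w (Sum.inl q))
          fun e => w (Sum.inr e) + sh e fun q => w (Sum.inl q)) * liftOp ℓ'.op : Op (Q ⊕ E))
          (Sum.elim u fun e => y e + x (root e)) (Sum.elim x' fun e => x' (root e)) =
        if y = 0 then tensorOp g x u * ℓ'.op u x' else 0 := by
      intro u
      rw [permOp_mul_apply hinv]
      simp only [liftOp, Matrix.of_apply, Sum.elim_inl, Sum.elim_inr]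
      by_cases hgu : tensorOp g x u = 0
      · simp [hgu]
      by_cases hu : ℓ'.op u x' = 0
      · simp [hu]
      have hxu : ∀ e, x (root e) = x' (root e) + sh e u := fun e => by
        rw [← hsh e _ _ hu]
        by_contra hne
        refine hgu (Finset.prod_eq_zero (Finset.mem_univ (root e)) ?_)
        rw [hg, Matrix.UnitaryGroup.one_val, Matrix.one_apply_ne hne]
      -- The corrected auxiliary bit is the mismatch a plus the output root bit b + c plus the flip
      -- c; `liftOp` requires it to equal the input root bit b.
      have hiff : ∀ a b c : Fin 2, a + (b + c) + c = b ↔ a = 0 := by decide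
      simp only [hxu, hiff, funext_iff, Pi.zero_apply, mul_ite, mul_zero]
    simp only [Sum.elim_inl, Sum.elim_inr, hterm]
    split_ifs <;> simp

end Units

/-! ### Two global `H`-type units sharing a control-`Z` gate -/

section Obstruction

theorem eq_zero_of_rank_eq_zero {m n : Type} [Fintype m] [Fintype n] {S : Matrix m n ℂ}
    (h : S.rank = 0) : S = 0 := by
  classical
  have h₀ : S.mulVecLin = 0 := LinearMap.range_eq_bot.1 (Submodule.finrank_eq_zero.1 h)
  ext i j
  simpa using congrFun (LinearMap.congr_fun h₀ (Pi.single j 1)) i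

variable {Q E : Type} [Fintype Q] [DecidableEq Q] [Fintype E] [DecidableEq E] {side : Q → Bool}
  {root : E → Q} {ℓ : Layer Q} {e₀ e₁ : E}

theorem not_hasJointEmbeddingRule_of_side_eq_false (hE : ∀ e, e = e₀ ∨ e = e₁)
    (h₀ : ℓ.IsHTypeUnit side (root e₀)) (h₁ : ℓ.IsHTypeUnit side (root e₁))
    (hcz : ℓ.IsGlobalCZ side (root e₀) (root e₁)) (hs₀ : side (root e₀) = false) :
    ¬ HasJointEmbeddingRule side root ℓ.op := by
  rintro ⟨L, K, hL, hK, hP⟩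
  have hs₁ : side (root e₁) = true := by simpa [hs₀] using hcz.2.2.symm
  have forallE : ∀ p : E → Prop, (∀ e, p e) ↔ p e₀ ∧ p e₁ := fun p =>
    ⟨fun h => ⟨h _, h _⟩, fun h e => (hE e).elim (fun he => he ▸ h.1) fun he => he ▸ h.2⟩
  obtain ⟨d₀, c₀, hc₀, h₀⟩ := h₀.exists_mul_apply_eq
  obtain ⟨d₁, c₁, hc₁, h₁⟩ := h₁.exists_mul_apply_eq
  have hop := Layer.op_apply_eq_mul_restCoeff hcz
  simp only [h₀, h₁] at hop
  have sQ₀ : auxSide side root (Sum.inl (root e₀)) = false := hs₀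
  have sQ₁ : auxSide side root (Sum.inl (root e₁)) = true := hs₁
  have sE₀ : auxSide side root (Sum.inr e₀) = true := by simp [auxSide, hs₀]
  have sE₁ : auxSide side root (Sum.inr e₁) = false := by simp [auxSide, hs₁]
  let S := realign (auxSide side root) (Matrix.of fun z w : Q ⊕ E → Fin 2 =>
    ℓ.restCoeff (root e₀) (root e₁) (fun q => z (Sum.inl q)) fun q => w (Sum.inl q))
  -- C_Z = ∑ i, |i⟩⟨i| ⊗ Z^i: `α i` and `β i` are the A and B factors of the i-th term, together
  -- with the identity on the auxiliary qubit of that system.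
  let α : Fin 2 → ({k // auxSide side root k = false} → Fin 2) ×
      ({k // auxSide side root k = false} → Fin 2) → ℂ := fun i p =>
    if p.1 ⟨_, sE₁⟩ = p.2 ⟨_, sE₁⟩ then c₀ (p.1 ⟨_, sQ₀⟩) (p.2 ⟨_, sQ₀⟩) *
      (-1) ^ (((p.1 ⟨_, sQ₀⟩ + p.2 ⟨_, sQ₀⟩ + d₀ : Fin 2) : ℕ) * (i : ℕ)) else 0
  let β : Fin 2 → ({k // auxSide side root k = true} → Fin 2) ×
      ({k // auxSide side root k = true} → Fin 2) → ℂ := fun i p =>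
    if p.1 ⟨_, sE₀⟩ = p.2 ⟨_, sE₀⟩ then ∑ j : Fin 2, c₁ (p.1 ⟨_, sQ₁⟩) (p.2 ⟨_, sQ₁⟩) *
      (-1) ^ (((p.1 ⟨_, sQ₁⟩ + p.2 ⟨_, sQ₁⟩ + d₁ : Fin 2) : ℕ) * (j : ℕ)) *
        (-1) ^ ((i : ℕ) * (j : ℕ)) else 0
  have hlift : realign (auxSide side root) (liftOp ℓ.op) =
      Matrix.diagonal (α 0) * S * Matrix.diagonal (β 0) +
        Matrix.diagonal (α 1) * S * Matrix.diagonal (β 1) := by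
    ext ⟨zA, wA⟩ ⟨zB, wB⟩
    rw [Matrix.add_apply, Matrix.mul_diagonal, Matrix.mul_diagonal, Matrix.diagonal_mul,
      Matrix.diagonal_mul]
    simp only [realign, liftOp, Matrix.of_apply, forallE, glue_of_false _ _ sE₁,
      glue_of_true _ _ sE₀, hop, glue_of_false _ _ sQ₀, glue_of_true _ _ sQ₁, α, β, S]
    by_cases hA : zA ⟨_, sE₁⟩ = wA ⟨_, sE₁⟩ <;> by_cases hB : zB ⟨_, sE₀⟩ = wB ⟨_, sE₀⟩ <;>
      simp [hA, hB, Fin.sum_univ_two]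
    ring
  have hupper : (realign (auxSide side root) (L * liftOp ℓ.op * K)).rank ≤ 2 * S.rank := by
    refine (rank_realign_mul_mul_le hL hK _).trans ?_
    rw [hlift, two_mul]
    exact (rank_add_le _ _).trans (add_le_add
      ((Matrix.rank_mul_le_left _ _).trans (Matrix.rank_mul_le_right _ _))
      ((Matrix.rank_mul_le_left _ _).trans (Matrix.rank_mul_le_right _ _)))
  -- Input bits on roots and auxiliary qubits are fixed to 0, a synchronised input. Rows choose the
  -- outputs of the first root and the second auxiliary qubit, columns those of the second root and
  -- the first auxiliary qubit. The swapped order in `σ` makes synchronised outputs exactly the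
  -- diagonal blocks.
  let ρ : (Fin 2 × Fin 2) × (({k // auxSide side root k = false} → Fin 2) ×
      ({k // auxSide side root k = false} → Fin 2)) → _ := fun p =>
    (Function.update (Function.update p.2.1 ⟨_, sQ₀⟩ p.1.1) ⟨_, sE₁⟩ p.1.2,
      Function.update (Function.update p.2.2 ⟨_, sQ₀⟩ 0) ⟨_, sE₁⟩ 0)
  let σ : (Fin 2 × Fin 2) × (({k // auxSide side root k = true} → Fin 2) ×
      ({k // auxSide side root k = true} → Fin 2)) → _ := fun p =>
    (Function.update (Function.update p.2.1 ⟨_, sQ₁⟩ p.1.2) ⟨_, sE₀⟩ p.1.1,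
      Function.update (Function.update p.2.2 ⟨_, sQ₁⟩ 0) ⟨_, sE₀⟩ 0)
  let f : Fin 2 × Fin 2 → ℂ := fun k => ∑ i : Fin 2, ∑ j : Fin 2,
    (c₀ k.1 0 * (-1) ^ (((k.1 + 0 + d₀ : Fin 2) : ℕ) * (i : ℕ))) *
      (c₁ k.2 0 * (-1) ^ (((k.2 + 0 + d₁ : Fin 2) : ℕ) * (j : ℕ))) * (-1) ^ ((i : ℕ) * (j : ℕ))
  -- With Hadamards on both sides of both qubits, the control-Z has no zero matrix element.
  have hf : ∀ k, f k ≠ 0 := by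
    intro k
    have : f k = c₀ k.1 0 * c₁ k.2 0 * ∑ i : Fin 2, ∑ j : Fin 2,
        (-1 : ℂ) ^ (((k.1 + 0 + d₀ : Fin 2) : ℕ) * (i : ℕ)) *
          (-1) ^ (((k.2 + 0 + d₁ : Fin 2) : ℕ) * (j : ℕ)) * (-1) ^ ((i : ℕ) * (j : ℕ)) := by
      simp only [f, Finset.mul_sum]
      exact Finset.sum_congr rfl fun i _ => Finset.sum_congr rfl fun j _ => by ring
    rw [this]
    exact mul_ne_zero (mul_ne_zero (hc₀ _ _) (hc₁ _ _)) (sum_sum_neg_one_pow_ne_zero _ _)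
  have hblocks : ∀ k p l r, (realign (auxSide side root) (L * liftOp ℓ.op * K)).submatrix ρ σ
      (k, p) (l, r) = if k = l then f k * S p r else 0 := by
    rintro ⟨i, j⟩ ⟨zA, wA⟩ ⟨k, l⟩ ⟨zB, wB⟩
    have hrest : ∀ (a₁ a₂ a₃ a₄ : Fin 2) (xA : {k // auxSide side root k = false} → Fin 2)
        (xB : {k // auxSide side root k = true} → Fin 2) (p : Q), p ≠ root e₀ → p ≠ root e₁ →
        glue (auxSide side root)
          (Function.update (Function.update xA ⟨_, sQ₀⟩ a₁) ⟨_, sE₁⟩ a₂)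
          (Function.update (Function.update xB ⟨_, sQ₁⟩ a₃) ⟨_, sE₀⟩ a₄) (Sum.inl p) =
        glue (auxSide side root) xA xB (Sum.inl p) := by
      intro a₁ a₂ a₃ a₄ xA xB p hp₀ hp₁
      cases hp : auxSide side root (Sum.inl p)
      · simp [glue_of_false _ _ hp, hp₀]
      · simp [glue_of_true _ _ hp, hp₁]
    simp only [Matrix.submatrix_apply, realign, Matrix.of_apply, ρ, σ, S]
    rw [hP.apply, hop, Layer.restCoeff_congr (hrest _ _ _ _ zA zB) (hrest _ _ _ _ wA wB)]
    · simp [forallE, glue_of_false _ _ sE₁, glue_of_true _ _ sE₀, glue_of_false _ _ sQ₀,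
        glue_of_true _ _ sQ₁, f]
      by_cases hjl : j = l
      · subst hjl
        simp only [eq_comm (a := k)]
      · simp [hjl]
    · simp [forallE, glue_of_false _ _ sE₁, glue_of_true _ _ sE₀, glue_of_false _ _ sQ₀,
        glue_of_true _ _ sQ₁]
  have hlower := (card_mul_rank_le_rank_of_blocks S _ f hf hblocks).trans
    (Matrix.rank_submatrix_le _ _ _)
  have hS : S = 0 := by
    refine eq_zero_of_rank_eq_zero ?_
    simp only [Fintype.card_prod, Fintype.card_fin] at hlower
    omega
  refine ℓ.op_ne_zero ?_
  ext x y
  have := congrFun (congrFun hS (fun k => Sum.elim x 0 k.1, fun k => Sum.elim y 0 k.1))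
    (fun k => Sum.elim x 0 k.1, fun k => Sum.elim y 0 k.1)
  simp only [S, realign, Matrix.of_apply, glue_restrict (Sum.elim x 0),
    glue_restrict (Sum.elim y 0), Sum.elim_inl, Matrix.zero_apply] at this
  rw [hop, this, mul_zero, Matrix.zero_apply]

theorem not_hasJointEmbeddingRule (hE : ∀ e, e = e₀ ∨ e = e₁)
    (h₀ : ℓ.IsHTypeUnit side (root e₀)) (h₁ : ℓ.IsHTypeUnit side (root e₁))
    (hcz : ℓ.IsGlobalCZ side (root e₀) (root e₁)) :
    ¬ HasJointEmbeddingRule side root ℓ.op := by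
  cases hs : side (root e₀)
  · exact not_hasJointEmbeddingRule_of_side_eq_false hE h₀ h₁ hcz hs
  · refine not_hasJointEmbeddingRule_of_side_eq_false (fun e => (hE e).symm) h₁ h₀ ?_ ?_
    · rw [Layer.IsGlobalCZ, Sym2.eq_swap]
      exact ⟨hcz.1, hcz.2.1, hcz.2.2.symm⟩
    · simpa [hs] using hcz.2.2

end Obstruction

/-! ### Compatibility of indecomposable embeddings -/

namespace Embedding

variable {Q : Type} [DecidableEq Q] {C : Circuit Q}

/-- The boundary gates of a D-type unit are diagonal or anti-diagonal around a node, exactly what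
the ends of an embedding require. Keeping the same cuts, both halves are embeddings, so such a unit
would make 𝓑 decomposable. -/
theorem isIdleUnit_or_isHTypeUnit {𝓑 : Embedding C} (h : ¬ 𝓑.IsDecomposable) {t : Fin C.depth}
    (ht : 𝓑.Covers t) {a b : Q → Gate1} (ha : a 𝓑.root = 𝓑.cut t.castSucc)
    (hb : b 𝓑.root = 𝓑.cut t.succ) :
    ((C.layer t).regroup a b).IsIdleUnit 𝓑.root ∨
      ((C.layer t).regroup a b).IsHTypeUnit C.side 𝓑.root := by
  have hu := 𝓑.units t ht.1 ht.2
  simp only [Layer.IsIdleUnit, Layer.IsDTypeUnit, Layer.IsHTypeUnit, Layer.regroup,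
    Pi.mulSingle_eq_same] at hu
  simp only [Layer.IsIdleUnit, Layer.IsHTypeUnit, Layer.regroup, ha, hb]
  rcases hu with hu | hu | hu
  · exact Or.inl hu
  · let 𝓑₁ : Embedding C := { 𝓑 with
      last := t
      first_lt_last := ht.1
      last_node := hu.1
      last_gate := hu.2.1
      units := fun s hs hst => 𝓑.units s hs (hst.trans ht.2) }
    let 𝓑₂ : Embedding C := { 𝓑 with
      first := t
      first_lt_last := ht.2
      first_node := hu.1
      first_gate := hu.2.2
      units := fun s hs hst => 𝓑.units s (ht.1.trans hs) hst }
    exact absurd ⟨t, ht, 𝓑₁, 𝓑₂, ⟨rfl, rfl, rfl⟩, ⟨rfl, rfl, rfl⟩⟩ h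
  · exact Or.inr hu

end Embedding

end DQC

end

theorem mainTheorem4 {Q : Type} [Fintype Q] [DecidableEq Q] (C : DQC.Circuit Q)
    (𝓑 𝓑' : DQC.Embedding C) (h : ¬ 𝓑.IsDecomposable) (h' : ¬ 𝓑'.IsDecomposable) :
    ¬ DQC.Embedding.Compatible ![𝓑, 𝓑'] ↔
      ∃ t : Fin C.depth, (𝓑.first < t ∧ t < 𝓑.last) ∧ (𝓑'.first < t ∧ t < 𝓑'.last) ∧
        (C.layer t).IsGlobalCZ C.side 𝓑.root 𝓑'.root := by
  have hind : ∀ i, ¬ (![𝓑, 𝓑'] i).IsDecomposable := by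
    intro i
    fin_cases i
    exacts [h, h']
  constructor
  · intro hincomp
    by_contra hno
    push Not at hno
    refine hincomp fun t a b hab => DQC.hasJointEmbeddingRule_of_units (fun i => ?_) ?_
    -- When the roots coincide, the grouping may follow the other embedding; the unit is then
    -- classified using that one.
    · rcases hab (![𝓑, 𝓑'] i.1).root with ⟨j, hj, hroot, ha, hb⟩ | ⟨hnot, -⟩
      · rw [← hroot] at ha hb ⊢
        exact DQC.Embedding.isIdleUnit_or_isHTypeUnit (hind j) hj ha hb
      · exact absurd rfl (hnot i.1 i.2)
    · rintro ⟨i, hi⟩ ⟨j, hj⟩ hcz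
      fin_cases i <;> fin_cases j
      · exact hcz.ne rfl
      · exact hno t hi hj hcz
      · refine hno t hj hi ⟨?_, ?_, hcz.2.2.symm⟩
        · rw [Sym2.eq_swap]
          exact hcz.1
        · rw [Sym2.eq_swap]
          exact hcz.2.1
      · exact hcz.ne rfl
  · rintro ⟨t, ht, ht', hcz⟩ hcomp
    have hne := hcz.ne
    -- Distinct roots allow the cuts of both embeddings to be used at once. Regrouping leaves the
    -- control-phase gates unchanged, so the shared control-Z persists and neither unit can be idle.
    let a : Fin (C.depth + 1) → Q → DQC.Gate1 := fun k q =>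
      if q = 𝓑.root then 𝓑.cut k else if q = 𝓑'.root then 𝓑'.cut k else 1
    have ha : ∀ k, a k 𝓑.root = 𝓑.cut k := fun k => if_pos rfl
    have ha' : ∀ k, a k 𝓑'.root = 𝓑'.cut k := fun k => by simp [a, hne.symm]
    have hgroup : DQC.Embedding.IsGrouping ![𝓑, 𝓑'] t (a t.castSucc) (a t.succ) := by
      intro q
      by_cases hq : q = 𝓑.root
      · subst hq
        exact Or.inl ⟨0, ht, rfl, ha _, ha _⟩
      by_cases hq' : q = 𝓑'.root
      · subst hq'
        exact Or.inl ⟨1, ht', rfl, ha' _, ha' _⟩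
      · refine Or.inr ⟨fun i _ => ?_, by simp [a, hq, hq'], by simp [a, hq, hq']⟩
        fin_cases i
        exacts [Ne.symm hq, Ne.symm hq']
    have hnode : ∀ q ∈ s(𝓑.root, 𝓑'.root),
        ((C.layer t).regroup (a t.castSucc) (a t.succ)).IsNode q := fun q hq => ⟨_, hcz.1, hq⟩
    refine DQC.not_hasJointEmbeddingRule (e₀ := ⟨0, ht⟩) (e₁ := ⟨1, ht'⟩) ?_ ?_ ?_ hcz
      (hcomp t _ _ hgroup)
    · rintro ⟨i, hi⟩
      fin_cases i
      exacts [Or.inl rfl, Or.inr rfl]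
    · exact (DQC.Embedding.isIdleUnit_or_isHTypeUnit h ht (ha _) (ha _)).resolve_left
        fun hi => hi.1 (hnode _ (Sym2.mem_mk_left _ _))
    · exact (DQC.Embedding.isIdleUnit_or_isHTypeUnit h' ht' (ha' _) (ha' _)).resolve_left
        fun hi => hi.1 (hnode _ (Sym2.mem_mk_right _ _))
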